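/- All graphs are finite and simple. A *maximal planar graph* (triangulation) is a connected plane graph all of whose faces, including the infinite one, are bounded by a cycle of length $3$. Let $G$ be a maximal planar graph, let $f$ be a proper vertex coloring of $G$ with color set $\{1,2,3,4\}$ (not necessarily using all colors), let $V_i$ be the set of vertices of color $i$, and let $G[i,j]$ be the subgraph of $G$ induced by $V_i\cup V_j$. The coloring $f$ is a *tree-coloring* if none of the graphs $G[i,j]$, $i\ne j$, contains a cycle. Let $H=G[1,2]\cup G[1,3]$ be the union of two bicolored subgraphs with a common color (the names of the colors are arbitrary), drawn in the plane as a part of $G$. A *suspending vertex* is a vertex of degree $0$ or $1$. A connected plane graph is a *fence* if the degree of every face (the length of its boundary walk, cut edges counted twice) is even and at least $4$. A *$t$-fence* is a fence in which the maximum, over all suspending vertices $v$, of the distance from $v$ to the nearest vertex lying on a cycle equals $t$ (this distance is $\infty$ if there is no such vertex); a fence without suspending vertices is a $0$-fence. Theorem 5.5. Then the following hold. (1) $H$ has no odd cycle. (2) Suppose that $|V(G)|\ge 4$ and that $G[1,2]$ and $G[1,3]$ both have at most $3$ vertices. If $|V_1|=2$, then $H$ is a cycle of length $4$. If $|V_1|\neq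 2$, then $H$ has no cycle, and $H$ is a tree provided that $f$ is a tree-coloring or that $G[1,2]$ and $G[1,3]$ are both connected. (3) If $f$ is a tree-coloring and $G[1,2]$ or $G[1,3]$ has at least $4$ vertices, then $H$ is a fence; it is a $0$-fence or a $1$-fence, unless exactly one vertex has color $1$ and $H$ is a tree. (4) If $|V(G)|\ge 4$ and $f$ is a tree-coloring, then every suspending vertex of $H$ is adjacent in $H$ to a vertex of the common color $1$. -/

import Mathlib

/-! ### First-return permutation -/

/-- For a permutation `σ` of a finite type and a point of `s`, some positive iterate of `σ`
returns to `s`. -/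
theorem Equiv.Perm.exists_return {α : Type*} [Finite α] (σ : Equiv.Perm α) (s : Set α) (x : s) :
    ∃ k : ℕ, (σ ^ (k + 1)) x.1 ∈ s := by
  refine ⟨orderOf σ - 1, ?_⟩
  have h : orderOf σ - 1 + 1 = orderOf σ := Nat.succ_pred_eq_of_pos (orderOf_pos σ)
  rw [h, pow_orderOf_eq_one]
  exact x.2

open Classical in
/-- One less than the first positive time at which the `σ`-orbit of `x ∈ s` is again in `s`. -/
noncomputable def Equiv.Perm.returnTime {α : Type*} [Finite α] (σ : Equiv.Perm α) (s : Set α)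
    (x : s) : ℕ :=
  Nat.find (σ.exists_return s x)

/-- The first point of `s` that is met by the sequence `σ x, σ (σ x), …`. -/
noncomputable def Equiv.Perm.firstReturnFun {α : Type*} [Finite α] (σ : Equiv.Perm α) (s : Set α)
    (x : s) : s :=
  ⟨(σ ^ (σ.returnTime s x + 1)) x.1, by
    classical
    exact Nat.find_spec (σ.exists_return s x)⟩

theorem Equiv.Perm.notMem_of_lt_returnTime {α : Type*} [Finite α] (σ : Equiv.Perm α) (s : Set α)
    (x : s) {k : ℕ} (hk : k < σ.returnTime s x) : (σ ^ (k + 1)) x.1 ∉ s := by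
  classical
  exact Nat.find_min (σ.exists_return s x) hk

theorem Equiv.Perm.firstReturnFun_injective {α : Type*} [Finite α] (σ : Equiv.Perm α)
    (s : Set α) : Function.Injective (σ.firstReturnFun s) := by
  have key : ∀ x y : s, σ.returnTime s x ≤ σ.returnTime s y →
      σ.firstReturnFun s x = σ.firstReturnFun s y → x = y := by
    intro x y hle h
    have h' : (σ ^ (σ.returnTime s x + 1)) x.1 = (σ ^ (σ.returnTime s y + 1)) y.1 :=
      congrArg Subtype.val h
    obtain ⟨j, hj⟩ := Nat.exists_eq_add_of_le hle
    rw [show σ.returnTime s y + 1 = (σ.returnTime s x + 1) + j by omega,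
      pow_add σ (σ.returnTime s x + 1) j, Equiv.Perm.mul_apply] at h'
    have hx : x.1 = (σ ^ j) y.1 := (σ ^ (σ.returnTime s x + 1)).injective h'
    rcases j with _ | j
    · exact Subtype.ext (by simpa using hx)
    · exact absurd (hx ▸ x.2) (σ.notMem_of_lt_returnTime s y (by omega))
  intro x y h
  rcases le_total (σ.returnTime s x) (σ.returnTime s y) with hle | hle
  · exact key x y hle h
  · exact (key y x hle h.symm).symm

/-- The permutation that `σ` induces on the subset `s`: go on along `σ` until `s` is met again. -/
noncomputable def Equiv.Perm.firstReturn {α : Type*} [Finite α] (σ : Equiv.Perm α) (s : Set α) :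
    Equiv.Perm s :=
  Equiv.ofBijective (σ.firstReturnFun s)
    (Finite.injective_iff_bijective.mp (σ.firstReturnFun_injective s))

theorem Equiv.Perm.firstReturn_sameCycle {α : Type*} [Finite α] (σ : Equiv.Perm α) (s : Set α)
    (x y : s) (h : σ.SameCycle x.1 y.1) : (σ.firstReturn s).SameCycle x y := by
  have key : ∀ n : ℕ, ∀ x : s, (σ ^ n) x.1 = y.1 → (σ.firstReturn s).SameCycle x y := by
    intro n
    induction n using Nat.strong_induction_on with
    | _ n ih =>
      intro x hn
      rcases n with _ | n
      · have : x = y := Subtype.ext (by simpa using hn)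
        exact this ▸ Equiv.Perm.SameCycle.refl _ _
      · have hle : σ.returnTime s x ≤ n := by
          by_contra hlt
          exact σ.notMem_of_lt_returnTime s x (not_le.mp hlt) (hn ▸ y.2)
        have h1 : (σ ^ (n - σ.returnTime s x)) (σ.firstReturn s x).1 = y.1 := by
          change (σ ^ (n - σ.returnTime s x)) ((σ ^ (σ.returnTime s x + 1)) x.1) = y.1
          rw [← Equiv.Perm.mul_apply, ← pow_add, ← hn]
          congr 2
          omega
        exact (ih _ (by omega) _ h1).of_apply_left
  obtain ⟨n, -, -, hn⟩ := h.exists_pow_eq''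
  exact key n x hn

namespace SimpleGraph

/-! ### Combinatorial embeddings -/

instance {V : Type*} [Finite V] (G : SimpleGraph V) : Finite G.Dart :=
  Finite.of_injective _ Dart.toProd_injective

/-- A drawing of a graph on an oriented closed surface (each component on a surface of its own),
given combinatorially by its rotation system: for every vertex `v`, a cyclic order of the darts
(directed edges) that start at `v`. -/
structure RotationSystem {V : Type*} (G : SimpleGraph V) where
  /-- the dart that follows a given dart in the cyclic order around their common start -/
  next : Equiv.Perm G.Dart
  isCycleOn : ∀ v : V, next.IsCycleOn {d | d.fst = v}

namespace RotationSystem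

/-- Walking along the boundary of a face: after traversing `d` from `u` to `v`, continue with the
dart that follows `v → u` in the cyclic order around `v`. -/
def faceNext {V : Type*} {G : SimpleGraph V} (R : G.RotationSystem) : Equiv.Perm G.Dart :=
  (Function.Involutive.toPerm Dart.symm Dart.symm_involutive).trans R.next

/-- The faces of a drawing of a connected graph (with at least one edge) are the orbits of darts
under `faceNext`. -/
def Face {V : Type*} {G : SimpleGraph V} (R : G.RotationSystem) : Type _ :=
  Quotient (Equiv.Perm.SameCycle.setoid R.faceNext)

/-- The degree of the face whose boundary walk contains the dart `d`: the number of edges of this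
walk, where a cut edge is counted twice since both of its darts occur. -/
noncomputable def faceDegree {V : Type*} {G : SimpleGraph V} (R : G.RotationSystem)
    (d : G.Dart) : ℕ :=
  {e | R.faceNext.SameCycle d e}.ncard

/-- A drawing of a connected finite graph with at least one edge is a drawing in the plane
(equivalently, on the sphere) if it satisfies Euler's formula `|V| + |F| = |E| + 2`. -/
def IsPlane {V : Type*} {G : SimpleGraph V} (R : G.RotationSystem) : Prop :=
  G.Connected ∧ Nat.card V + Nat.card R.Face = G.edgeSet.ncard + 2

/-- The graph, drawn in the plane by `R`, is a maximal planar graph (triangulation): every face,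
including the infinite one, is bounded by a cycle of length 3. (In a simple graph, a closed walk
of length 3 is a 3-cycle.) -/
def IsMaximalPlanar {V : Type*} {G : SimpleGraph V} (R : G.RotationSystem) : Prop :=
  R.IsPlane ∧ ∀ d : G.Dart, R.faceDegree d = 3

/-- The drawing of a subgraph `H` of `G` inherited from a drawing of `G`: all vertices and edges
outside `H` are erased, so that the cyclic order around a vertex of `H` is the one of `G` with the
missing darts skipped. -/
noncomputable def restrict {V : Type*} [Finite V] {G : SimpleGraph V} (R : G.RotationSystem)
    (H : G.Subgraph) : H.coe.RotationSystem :=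
  let e : H.coe.Dart ≃ {d : G.Dart | H.Adj d.fst d.snd} :=
    { toFun := fun d => ⟨⟨(d.fst.1, d.snd.1), H.adj_sub d.adj⟩, d.adj⟩
      invFun := fun d => ⟨(⟨d.1.fst, H.edge_vert d.2⟩, ⟨d.1.snd, H.edge_vert d.2.symm⟩), d.2⟩
      left_inv := fun _ => rfl
      right_inv := fun _ => rfl }
  { next := e.trans ((R.next.firstReturn {d : G.Dart | H.Adj d.fst d.snd}).trans e.symm)
    isCycleOn := by
      have hpow : ∀ (n : ℕ) (d : G.Dart), ((R.next ^ n) d).fst = d.fst := by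
        intro n
        induction n with
        | zero => intro d; rfl
        | succ n ih =>
          intro d
          rw [pow_succ, Equiv.Perm.mul_apply, ih]
          exact (R.isCycleOn d.fst).1.1 (show d ∈ {d' : G.Dart | d'.fst = d.fst} from rfl)
      set τ := R.next.firstReturn {d : G.Dart | H.Adj d.fst d.snd} with hτ
      have hτfst : ∀ d, (τ d).1.fst = d.1.fst := fun d => hpow _ d.1
      have hconj : ∀ (n : ℤ) (d : H.coe.Dart),
          ((e.trans (τ.trans e.symm) : Equiv.Perm H.coe.Dart) ^ n) d
            = e.symm ((τ ^ n) (e d)) := by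
        have hc : (e.trans (τ.trans e.symm) : Equiv.Perm H.coe.Dart) = e.symm.permCongr τ := by
          ext1 d
          simp [Equiv.permCongr_apply]
        intro n d
        have hz := map_zpow (e.symm.permCongrHom) τ n
        rw [hc]
        change ((e.symm.permCongrHom τ) ^ n) d = _
        rw [← hz]
        rfl
      have hmaps : ∀ d : H.coe.Dart, ((e.trans (τ.trans e.symm)) d).fst = d.fst :=
        fun d => Subtype.ext (hτfst (e d))
      intro v
      refine ⟨⟨fun d hd => (hmaps d).trans hd, (Equiv.injective _).injOn, fun d hd => ?_⟩, ?_⟩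
      · obtain ⟨d', rfl⟩ := (e.trans (τ.trans e.symm)).surjective d
        exact ⟨d', (hmaps d').symm.trans hd, rfl⟩
      · intro d hd d' hd'
        have h1 : R.next.SameCycle (e d).1 (e d').1 :=
          (R.isCycleOn v.1).2 (congrArg Subtype.val hd) (congrArg Subtype.val hd')
        obtain ⟨n, hn⟩ := R.next.firstReturn_sameCycle _ (e d) (e d') h1
        refine ⟨n, ?_⟩
        rw [hconj, hn, Equiv.symm_apply_apply] }

/-- A connected plane graph is a fence if the degree of each of its faces is even and at least 4.
(A disconnected fence never is a `t`-fence for a finite `t`; it is not needed here.) -/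
def IsFence {V : Type*} {G : SimpleGraph V} (R : G.RotationSystem) : Prop :=
  G.Connected ∧ ∀ d : G.Dart, Even (R.faceDegree d) ∧ 4 ≤ R.faceDegree d

end RotationSystem

/-! ### Suspending vertices -/

/-- A suspending vertex is a vertex of degree 0 or 1. -/
def IsSuspending {V : Type*} (G : SimpleGraph V) (v : V) : Prop :=
  (G.neighborSet v).encard ≤ 1

/-- The distance from `v` to the nearest vertex that lies on a cycle (for a suspending vertex `v`
this is its weld-vertex); it is `⊤` if no vertex of a cycle can be reached from `v`. -/
noncomputable def cycleDist {V : Type*} (G : SimpleGraph V) (v : V) : ℕ∞ :=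
  ⨅ u ∈ {u : V | ∃ w : G.Walk u u, w.IsCycle}, G.edist v u

/-- The maximum distance from a suspending vertex to its weld-vertex; it is `0` if there is no
suspending vertex, and `⊤` if some suspending vertex is not connected to any cycle. -/
noncomputable def suspensionDepth {V : Type*} (G : SimpleGraph V) : ℕ∞ :=
  ⨆ v ∈ {v : V | G.IsSuspending v}, G.cycleDist v

/-- A `t`-fence is a fence in which the maximum distance from a suspending vertex to its
weld-vertex is `t`; a fence without suspending vertices is a `0`-fence. -/
def RotationSystem.IsTFence {V : Type*} {G : SimpleGraph V} (R : G.RotationSystem) (t : ℕ) :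
    Prop :=
  R.IsFence ∧ G.suspensionDepth = t

/-! ### Bicolored subgraphs -/

/-- The bicolored subgraph `G[i, j]`, induced by the vertices of colors `i` and `j`. -/
def Coloring.bicolored {V C : Type*} {G : SimpleGraph V} (f : G.Coloring C) (i j : C) :
    G.Subgraph :=
  (⊤ : G.Subgraph).induce {v | f v = i ∨ f v = j}

/-- A tree-coloring is a coloring without a bicolored cycle. -/
def Coloring.IsTreeColoring {V C : Type*} {G : SimpleGraph V} (f : G.Coloring C) : Prop :=
  ∀ i j : C, i ≠ j → (f.bicolored i j).coe.IsAcyclic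

end SimpleGraph

/-! Write `a` for the common color and `b`, `c` for the other two. Every edge of $H$ joins `a` to a
different color, so $H$ is bipartite: it has no odd cycle, and its faces have even degree. A face of
degree 2 would leave a component with only two vertices, so connectedness and three vertices suffice
for a fence.

Connectedness comes from counting. In a triangulation with at least four vertices, consecutive
neighbors around $v$ are adjacent, and the two that flank a given neighbor differ. Hence the
neighbors of $v$ cannot induce a forest, and under a tree-coloring every vertex sees all three other
colors (`IsTreeColoring.exists_adj_color`); this gives (4). The six bicolored forests have at most
$|V_i|+|V_j|-1$ edges each, in total $3|V|-6=|E|$, so each of them is a tree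
(`IsTreeColoring.connected_bicolored`).

If two vertices have color `a`, paths between them in the two edge-disjoint trees put each of them
on a cycle (`Subgraph.exists_isCycle_sup`), and suspending vertices are adjacent to such vertices.
If only one vertex has color `a`, then $H$ is a star.

In (2) the coloring need not be a tree-coloring. There, a vertex that misses a color has neighbors
of alternating colors, so each of these colors is used at least twice
(`exists_adj_color_of_ncard_le_one`). -/

theorem Setoid.card_eq_mul_card_quotient {α : Type*} [Finite α] (r : Setoid α) {k : ℕ}
    (h : ∀ a, {b | r a b}.ncard = k) : Nat.card α = k * Nat.card (Quotient r) := by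
  classical
  have := Fintype.ofFinite α
  have := Fintype.ofFinite (Quotient r)
  have hs := Finset.card_eq_sum_card_fiberwise (s := (Finset.univ : Finset α))
    (t := (Finset.univ : Finset (Quotient r))) (f := Quotient.mk r) (fun _ _ => by simp)
  rw [Nat.card_eq_fintype_card, Nat.card_eq_fintype_card, ← Finset.card_univ, hs,
    Finset.sum_const_nat (m := k), Finset.card_univ, mul_comm]
  intro q _
  induction q using Quotient.inductionOn with
  | _ a =>
    rw [← h a, ← Set.ncard_coe_finset]
    congr 1
    ext b
    simp only [Finset.coe_filter, Finset.mem_univ, true_and, Set.mem_ofPred_eq]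
    exact Quotient.eq.trans ⟨r.symm, r.symm⟩

namespace SimpleGraph

/-! ### Forests and connectivity -/

theorem Connected.mem_of_adj_closed {V : Type*} {G : SimpleGraph V} (hG : G.Connected) {s : Set V}
    (hs : ∀ u ∈ s, ∀ v, G.Adj u v → v ∈ s) {u : V} (hu : u ∈ s) (v : V) : v ∈ s := by
  obtain ⟨w⟩ := hG.preconnected u v
  induction w with
  | nil => exact hu
  | cons h _ ih => exact ih (hs _ hu _ h)

/-- Forests inherit their edge bounds and leaves from a tree on the same vertices, whether or not
they are connected. -/
theorem IsAcyclic.exists_isTree_ge {V : Type*} [Nonempty V] {G : SimpleGraph V}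
    (hG : G.IsAcyclic) : ∃ T, G ≤ T ∧ T.IsTree := by
  obtain ⟨T, hGT, -, hT⟩ :=
    (connected_top (V := V)).exists_isTree_le_of_le_of_isAcyclic le_top hG
  exact ⟨T, hGT, hT⟩

theorem IsAcyclic.ncard_edgeSet_lt {V : Type*} [Finite V] [Nonempty V] {G : SimpleGraph V}
    (hG : G.IsAcyclic) : G.edgeSet.ncard + 1 ≤ Nat.card V := by
  obtain ⟨T, hGT, hT⟩ := hG.exists_isTree_ge
  have h := (isTree_iff_connected_and_card.1 hT).2
  rw [Nat.card_coe_set_eq] at h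
  rw [← h]
  exact Nat.succ_le_succ (Set.ncard_le_ncard (edgeSet_mono hGT) (Set.toFinite _))

theorem IsAcyclic.connected_of_card_le {V : Type*} [Finite V] [Nonempty V] {G : SimpleGraph V}
    (hG : G.IsAcyclic) (h : Nat.card V ≤ G.edgeSet.ncard + 1) : G.Connected := by
  obtain ⟨T, hGT, hT⟩ := hG.exists_isTree_ge
  have h' := (isTree_iff_connected_and_card.1 hT).2
  rw [Nat.card_coe_set_eq] at h'
  have : G.edgeSet = T.edgeSet :=
    Set.eq_of_subset_of_ncard_le (edgeSet_mono hGT) (by omega) (Set.toFinite _)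
  rw [edgeSet_injective this]
  exact hT.1

theorem IsAcyclic.exists_neighborSet_subsingleton {V : Type*} [Finite V] [Nonempty V]
    {G : SimpleGraph V} (hG : G.IsAcyclic) : ∃ v, (G.neighborSet v).Subsingleton := by
  classical
  obtain ⟨T, hGT, hT⟩ := hG.exists_isTree_ge
  have := Fintype.ofFinite V
  cases subsingleton_or_nontrivial V with
  | inl h => exact ⟨Classical.arbitrary V, Set.subsingleton_of_subsingleton⟩
  | inr h =>
    obtain ⟨v, hv⟩ := hT.exists_vert_degree_one_of_nontrivial
    obtain ⟨u, -, hu⟩ := degree_eq_one_iff_existsUnique_adj.1 hv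
    exact ⟨v, fun x hx y hy => (hu x (hGT hx)).trans (hu y (hGT hy)).symm⟩

/-- An edge is on a cycle if its ends are joined by a walk that avoids the edge. -/
theorem exists_isCycle_of_reachable_deleteEdges {V : Type*} {G : SimpleGraph V} {u v : V}
    (h : G.Adj u v) (hr : (G.deleteEdges {s(u, v)}).Reachable u v) :
    ∃ w : G.Walk u u, w.IsCycle := by
  obtain ⟨x, p, hp, he⟩ := adj_and_reachable_delete_edges_iff_exists_cycle.1 ⟨h, hr⟩
  classical
  exact ⟨p.rotate u (p.fst_mem_support_of_mem_edges he), hp.rotate _⟩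

namespace RotationSystem

/-! ### Faces of a rotation system -/

variable {V : Type*} {G : SimpleGraph V}

theorem fst_next (R : G.RotationSystem) (d : G.Dart) : (R.next d).fst = d.fst :=
  (R.isCycleOn d.fst).1.1 (show d ∈ {e : G.Dart | e.fst = d.fst} from rfl)

theorem faceNext_apply (R : G.RotationSystem) (d : G.Dart) :
    R.faceNext d = R.next d.symm := rfl

theorem fst_faceNext (R : G.RotationSystem) (d : G.Dart) : (R.faceNext d).fst = d.snd :=
  R.fst_next d.symm

/-- A set of darts that is closed under `next` contains all darts that start where one of its
members does. -/
theorem mem_of_next_closed (R : G.RotationSystem) [Finite V] {s : Set G.Dart}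
    (hs : ∀ d ∈ s, R.next d ∈ s) {d e : G.Dart} (hd : d ∈ s) (h : d.fst = e.fst) : e ∈ s := by
  obtain ⟨n, -, -, hn⟩ := ((R.isCycleOn d.fst).2 rfl h.symm).exists_pow_eq''
  rw [← hn]
  clear hn
  induction n with
  | zero => exact hd
  | succ n ih => rw [pow_succ', Equiv.Perm.mul_apply]; exact hs _ ih

/-- Each step of `faceNext` changes the color of the start, so it maps one color class of the face
bijectively onto the other. -/
theorem even_faceDegree [Finite V] (R : G.RotationSystem) (f : G.Coloring Bool) (d : G.Dart) :
    Even (R.faceDegree d) := by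
  set A : Set G.Dart := {e | R.faceNext.SameCycle d e ∧ f e.fst = true}
  set B : Set G.Dart := {e | R.faceNext.SameCycle d e ∧ f e.fst = false}
  have hf : ∀ e, f (R.faceNext e).fst = !f e.fst := by
    intro e
    rw [R.fst_faceNext]
    have := f.valid e.adj
    change f e.fst ≠ f e.snd at this
    revert this
    cases f e.fst <;> cases f e.snd <;> simp
  have hAB : R.faceNext '' A = B := by
    ext e
    constructor
    · rintro ⟨e, he, rfl⟩
      exact ⟨he.1.apply_right, by rw [hf, he.2]; rfl⟩
    · intro he
      refine ⟨R.faceNext.symm e, ⟨?_, ?_⟩, by simp⟩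
      · exact Equiv.Perm.sameCycle_symm_apply_right.2 he.1
      · have := hf (R.faceNext.symm e)
        rw [Equiv.apply_symm_apply, he.2] at this
        simpa using this.symm
  have hU : {e | R.faceNext.SameCycle d e} = A ∪ B := by
    ext e
    cases h : f e.fst <;> simp [A, B, h]
  have hdisj : Disjoint A B := by
    rw [Set.disjoint_left]
    rintro e ⟨-, h1⟩ ⟨-, h2⟩
    simp [h1] at h2
  rw [faceDegree, hU, Set.ncard_union_eq hdisj (Set.toFinite _) (Set.toFinite _), ← hAB,
    Set.ncard_image_of_injective _ R.faceNext.injective]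
  exact ⟨_, rfl⟩

theorem isFence_of_coloring_bool [Finite V] (R : G.RotationSystem) (f : G.Coloring Bool)
    (hG : G.Connected) (hV : 3 ≤ Nat.card V) : R.IsFence := by
  refine ⟨hG, fun d => ⟨R.even_faceDegree f d, ?_⟩⟩
  obtain ⟨k, hk⟩ := R.even_faceDegree f d
  by_contra hlt
  have hne : R.faceNext d ≠ d := by
    intro h
    have h1 := R.fst_faceNext d
    rw [h] at h1
    exact d.adj.ne h1
  have hsub : ({d, R.faceNext d} : Set G.Dart) ⊆ {e | R.faceNext.SameCycle d e} := by
    rintro e (rfl | rfl)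
    · exact Equiv.Perm.SameCycle.refl _ _
    · exact (Equiv.Perm.SameCycle.refl _ _).apply_right
  have hle := Set.ncard_le_ncard hsub (Set.toFinite _)
  rw [Set.ncard_pair hne.symm] at hle
  change 2 ≤ R.faceDegree d at hle
  have heq : ({d, R.faceNext d} : Set G.Dart) = {e | R.faceNext.SameCycle d e} := by
    refine Set.eq_of_subset_of_ncard_le hsub ?_ (Set.toFinite _)
    rw [Set.ncard_pair hne.symm]
    change R.faceDegree d ≤ 2
    omega
  have hmem : R.faceNext (R.faceNext d) ∈ ({d, R.faceNext d} : Set G.Dart) := by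
    rw [heq]
    exact (Equiv.Perm.SameCycle.refl _ _).apply_right.apply_right
  have h2 : R.faceNext (R.faceNext d) = d := by
    rcases hmem with h | h
    · exact h
    · exact absurd (R.faceNext.injective h) hne
  -- A face of degree 2 runs along an edge and back, so `next` fixes both darts of this edge. Its
  -- ends then have no other neighbors.
  have h1 : R.faceNext d = d.symm := by
    apply Dart.ext
    apply Prod.ext
    · exact R.fst_faceNext d
    · exact ((R.fst_faceNext _).symm.trans (congrArg (fun e : G.Dart => e.fst) h2))
  have hn1 : R.next d.symm = d.symm := h1
  have hn2 : R.next d = d := by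
    rw [h1, faceNext_apply, Dart.symm_symm] at h2
    exact h2
  have hall : ∀ v, v ∈ ({d.fst, d.snd} : Set V) := by
    refine hG.mem_of_adj_closed ?_ (Set.mem_insert d.fst _)
    rintro u (rfl | rfl) v huv
    · have := R.mem_of_next_closed (s := {d}) (e := ⟨(_, v), huv⟩)
        (by rintro e rfl; exact hn2) (Set.mem_singleton d) rfl
      exact Or.inr (congrArg (fun e : G.Dart => e.snd) this)
    · have := R.mem_of_next_closed (s := {d.symm}) (e := ⟨(_, v), huv⟩)
        (by rintro e rfl; exact hn1) (Set.mem_singleton _) rfl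
      exact Or.inl (congrArg (fun e : G.Dart => e.snd) this)
  have : Nat.card V ≤ 2 := by
    rw [← Set.ncard_univ, ← Set.eq_univ_of_forall hall]
    simp
  omega

/-! ### Triangulations -/

theorem faceNext_faceNext_faceNext [Finite V] (R : G.RotationSystem) {d : G.Dart}
    (h : R.faceDegree d = 3) : R.faceNext (R.faceNext (R.faceNext d)) = d := by
  have hs : R.faceNext.IsCycleOn ({e | R.faceNext.SameCycle d e}.toFinite.toFinset : Set G.Dart) := by
    rw [Set.Finite.coe_toFinset]
    refine ⟨⟨fun e he => Equiv.Perm.SameCycle.apply_right he, R.faceNext.injective.injOn,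
      fun e he => ⟨R.faceNext.symm e, ?_, by simp⟩⟩, fun x hx y hy => hx.symm.trans hy⟩
    exact Equiv.Perm.sameCycle_symm_apply_right.2 he
  have := hs.pow_card_apply (a := d) (by simpa using Equiv.Perm.SameCycle.refl _ _)
  rw [← Set.ncard_eq_toFinset_card] at this
  change (R.faceNext ^ R.faceDegree d) d = d at this
  rw [h] at this
  exact this

/-- Three consecutive corners of a triangular face. -/
theorem next_eq_of_faceDegree [Finite V] (R : G.RotationSystem) (h : ∀ d, R.faceDegree d = 3)
    {x y z : V} (hxy : G.Adj x y) (hxz : G.Adj x z)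
    (hn : R.next ⟨(x, y), hxy⟩ = ⟨(x, z), hxz⟩) :
    ∃ hyz : G.Adj y z, R.next ⟨(z, x), hxz.symm⟩ = ⟨(z, y), hyz.symm⟩ := by
  have h3 := R.faceNext_faceNext_faceNext (h ⟨(y, x), hxy.symm⟩)
  have e1 : R.faceNext ⟨(y, x), hxy.symm⟩ = ⟨(x, z), hxz⟩ := hn
  rw [e1] at h3
  have hf : (R.faceNext ⟨(x, z), hxz⟩).fst = z := R.fst_faceNext _
  have hs : (R.faceNext ⟨(x, z), hxz⟩).snd = y := by
    rw [← R.fst_faceNext, h3]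
  have hzy : G.Adj z y := by
    have := (R.faceNext ⟨(x, z), hxz⟩).adj
    change G.Adj (R.faceNext ⟨(x, z), hxz⟩).fst (R.faceNext ⟨(x, z), hxz⟩).snd at this
    rwa [hf, hs] at this
  refine ⟨hzy.symm, ?_⟩
  change R.faceNext ⟨(x, z), hxz⟩ = _
  exact Dart.ext _ _ (Prod.ext hf hs)

/-- The two darts bound a common triangle. Thus the neighbors of a vertex, in cyclic order, form a
closed walk. -/
theorem adj_snd_next [Finite V] (R : G.RotationSystem) (h : ∀ d, R.faceDegree d = 3)
    (d : G.Dart) : G.Adj d.snd (R.next d).snd := by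
  have hadj : G.Adj d.fst (R.next d).snd := by
    have := (R.next d).adj
    change G.Adj (R.next d).fst (R.next d).snd at this
    rwa [R.fst_next] at this
  exact (R.next_eq_of_faceDegree h d.adj hadj
    (Dart.ext _ _ (Prod.ext (R.fst_next d) rfl))).1

/-- Otherwise $v$ has only the neighbors $y$ and $z$; the two triangles at $v$ then close up the
rotations at $y$ and $z$ too, and the graph is a single triangle. -/
theorem next_next_ne [Finite V] (R : G.RotationSystem) (h : ∀ d, R.faceDegree d = 3)
    (hG : G.Connected) (hV : 4 ≤ Nat.card V) (d : G.Dart) : R.next (R.next d) ≠ d := by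
  intro hd
  obtain ⟨⟨v, y⟩, hvy⟩ := d
  change G.Adj v y at hvy
  obtain ⟨z, hvz, hn⟩ : ∃ z, ∃ hvz : G.Adj v z, R.next ⟨(v, y), hvy⟩ = ⟨(v, z), hvz⟩ := by
    have hf : (R.next ⟨(v, y), hvy⟩).fst = v := R.fst_next _
    have := (R.next ⟨(v, y), hvy⟩).adj
    change G.Adj (R.next ⟨(v, y), hvy⟩).fst (R.next ⟨(v, y), hvy⟩).snd at this
    rw [hf] at this
    exact ⟨_, this, Dart.ext _ _ (Prod.ext hf rfl)⟩
  rw [hn] at hd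
  obtain ⟨hyz, h1⟩ := R.next_eq_of_faceDegree h hvy hvz hn
  obtain ⟨_, h2⟩ := R.next_eq_of_faceDegree h hvz hvy hd
  obtain ⟨_, h3⟩ := R.next_eq_of_faceDegree h _ _ h1
  obtain ⟨_, h4⟩ := R.next_eq_of_faceDegree h _ _ h2
  have key : ∀ {x p q : V} (hp : G.Adj x p) (hq : G.Adj x q),
      R.next ⟨(x, p), hp⟩ = ⟨(x, q), hq⟩ → R.next ⟨(x, q), hq⟩ = ⟨(x, p), hp⟩ →
      ∀ u, G.Adj x u → u = p ∨ u = q := by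
    intro x p q hp hq e1 e2 u hu
    have := R.mem_of_next_closed (s := {⟨(x, p), hp⟩, ⟨(x, q), hq⟩}) (e := ⟨(x, u), hu⟩)
      (by rintro e (rfl | rfl)
          · exact Or.inr e1
          · exact Or.inl e2) (Set.mem_insert _ _) rfl
    exact this.imp (congrArg (fun e : G.Dart => e.snd)) (congrArg (fun e : G.Dart => e.snd))
  have hall : ∀ u, u ∈ ({v, y, z} : Set V) := by
    refine hG.mem_of_adj_closed ?_ (Set.mem_insert v _)
    rintro u (rfl | rfl | rfl) w hw
    · rcases key _ _ hn hd w hw with rfl | rfl <;> simp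
    · rcases key _ _ h2 h3 w hw with rfl | rfl <;> simp
    · rcases key _ _ h1 h4 w hw with rfl | rfl <;> simp
  have : Nat.card V ≤ 3 := by
    rw [← Set.ncard_univ, ← Set.eq_univ_of_forall hall]
    refine (Set.ncard_insert_le _ _).trans (Nat.succ_le_succ ?_)
    simpa using Set.ncard_insert_le y {z}
  omega

theorem card_dart_eq [Finite V] (R : G.RotationSystem) (h : ∀ d, R.faceDegree d = 3) :
    Nat.card G.Dart = 3 * Nat.card R.Face := by
  refine Setoid.card_eq_mul_card_quotient _ fun d => ?_
  exact h d

/-- Counting darts by edges and by faces gives $2|E|=3|F|$; insert this into Euler's formula. -/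
theorem IsMaximalPlanar.ncard_edgeSet [Finite V] {R : G.RotationSystem}
    (hR : R.IsMaximalPlanar) : G.edgeSet.ncard + 6 = 3 * Nat.card V := by
  classical
  have h1 := R.card_dart_eq hR.2
  have h2 := hR.1.2
  have := Fintype.ofFinite V
  have h3 := G.dart_card_eq_twice_card_edges
  rw [← Nat.card_eq_fintype_card, ← Set.ncard_coe_finset, coe_edgeFinset] at h3
  omega

theorem _root_.SimpleGraph.Connected.exists_adj [Finite V] (hG : G.Connected) (hV : 2 ≤ Nat.card V) (v : V) :
    ∃ u, G.Adj v u := by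
  by_contra! hno
  have hall : ∀ u, u ∈ ({v} : Set V) :=
    hG.mem_of_adj_closed (by rintro u rfl w hw; exact absurd hw (hno w)) rfl
  have : Nat.card V ≤ 1 := by
    rw [← Set.ncard_univ, ← Set.eq_univ_of_forall hall, Set.ncard_singleton]
  omega

end RotationSystem

/-! ### Colorings of triangulations -/

theorem Subgraph.ncard_edgeSet_coe {V : Type*} {G : SimpleGraph V} (H : G.Subgraph) :
    H.coe.edgeSet.ncard = H.edgeSet.ncard := by
  rw [← Subgraph.image_coe_edgeSet_coe,
    Set.ncard_image_of_injective _ (Sym2.map.injective Subtype.val_injective)]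

theorem Coloring.bicolored_comm {V C : Type*} {G : SimpleGraph V} (f : G.Coloring C) (i j : C) :
    f.bicolored i j = f.bicolored j i := by
  rw [bicolored, bicolored]
  congr 1
  ext v
  exact or_comm

section Triangulation

variable {V : Type*} [Finite V] {G : SimpleGraph V}

theorem RotationSystem.snd_next_next_ne (R : G.RotationSystem) (hR : R.IsMaximalPlanar)
    (hV : 4 ≤ Nat.card V) (d : G.Dart) : (R.next (R.next d)).snd ≠ d.snd := by
  intro h
  refine R.next_next_ne hR.2 hR.1.1 hV d (Dart.ext _ _ (Prod.ext ?_ h))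
  exact (R.fst_next _).trans (R.fst_next d)

theorem exists_two_other_colors (x y : Fin 4) (h : x ≠ y) :
    ∃ z w : Fin 4, z ≠ w ∧ ∀ t, t ≠ x → t ≠ y → t = z ∨ t = w := by
  revert x y
  decide

/-- If $v$ misses a color, its neighbors carry only two colors and so induce a forest. But each
neighbor is adjacent to its predecessor and its successor around $v$, which are distinct, so this
forest would have no vertex of degree at most 1. -/
theorem Coloring.IsTreeColoring.exists_adj_color {f : G.Coloring (Fin 4)}
    (hf : f.IsTreeColoring) {R : G.RotationSystem} (hR : R.IsMaximalPlanar)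
    (hV : 4 ≤ Nat.card V) (v : V) {y : Fin 4} (hy : f v ≠ y) : ∃ u, G.Adj v u ∧ f u = y := by
  by_contra! hno
  obtain ⟨z, w, hzw, hcol⟩ := exists_two_other_colors _ _ hy
  have hmem : ∀ u, G.Adj v u → f u = z ∨ f u = w :=
    fun u hu => hcol _ (f.valid hu).symm (hno u hu)
  let g : G.induce (G.neighborSet v) →g (f.bicolored z w).coe :=
    { toFun := fun u => ⟨u.1, hmem u.1 u.2⟩
      map_rel' := fun {p q} hpq => ⟨hmem p.1 p.2, hmem q.1 q.2, hpq⟩ }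
  have hac : (G.induce (G.neighborSet v)).IsAcyclic :=
    (hf z w hzw).comap g fun p q hpq => Subtype.ext (congrArg (fun t => t.1) hpq)
  obtain ⟨u, hu⟩ := hR.1.1.exists_adj (by omega) v
  have : Nonempty (G.neighborSet v) := ⟨⟨u, hu⟩⟩
  obtain ⟨⟨p, hp⟩, hsub⟩ := hac.exists_neighborSet_subsingleton
  set d : G.Dart := ⟨(v, p), hp⟩
  obtain ⟨e, he⟩ := R.next.surjective d
  have hev : e.fst = v := by rw [← R.fst_next, he]
  have hdv : (R.next d).fst = v := R.fst_next d
  have hea : G.Adj v e.snd := hev ▸ e.adj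
  have hda : G.Adj v (R.next d).snd := hdv ▸ (R.next d).adj
  have h1 : G.Adj p e.snd := by
    have := R.adj_snd_next hR.2 e
    rw [he] at this
    exact this.symm
  have h2 : G.Adj p (R.next d).snd := R.adj_snd_next hR.2 d
  have := hsub (show (⟨_, hda⟩ : G.neighborSet v) ∈ _ from h2)
    (show (⟨_, hea⟩ : G.neighborSet v) ∈ _ from h1)
  have hsnd : (R.next d).snd = e.snd := congrArg Subtype.val this
  rw [← he] at hsnd
  exact R.snd_next_next_ne hR hV e hsnd

/-- In a triangulation, the colors of the neighbors of a vertex that misses a color alternate, so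
that both other colors occur twice. -/
theorem Coloring.exists_adj_color_of_ncard_le_one (f : G.Coloring (Fin 4))
    {R : G.RotationSystem} (hR : R.IsMaximalPlanar) (hV : 4 ≤ Nat.card V) (v : V) {y z : Fin 4}
    (hy : f v ≠ y) (hz : f v ≠ z) (hyz : y ≠ z) (hcard : {u | f u = z}.ncard ≤ 1) :
    ∃ u, G.Adj v u ∧ f u = y := by
  by_contra! hno
  obtain ⟨u, hu⟩ := hR.1.1.exists_adj (by omega) v
  have hnext : ∀ e : G.Dart, e.fst = v → f (R.next e).snd ≠ f v ∧ f (R.next e).snd ≠ y ∧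
      f e.snd ≠ f (R.next e).snd := by
    intro e he
    have hfst : (R.next e).fst = v := (R.fst_next e).trans he
    have ha : G.Adj v (R.next e).snd := hfst ▸ (R.next e).adj
    exact ⟨(f.valid ha).symm, hno _ ha, f.valid (R.adj_snd_next hR.2 e)⟩
  -- Once `s` and `t` are excluded, only `r` and one more color remain, so of two different colors
  -- one is `r`.
  have key : ∀ p q r s t : Fin 4, s ≠ t → s ≠ r → t ≠ r → p ≠ s → p ≠ t → q ≠ s → q ≠ t → p ≠ q →
      p = r ∨ q = r := by decide
  have hex : ∃ e : G.Dart, e.fst = v ∧ f e.snd = z := by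
    obtain ⟨h1, h2, h3⟩ := hnext ⟨(v, u), hu⟩ rfl
    rcases key _ _ z _ _ hy hz hyz (f.valid hu).symm (hno u hu) h1 h2 h3 with h | h
    · exact ⟨⟨(v, u), hu⟩, rfl, h⟩
    · exact ⟨R.next ⟨(v, u), hu⟩, R.fst_next _, h⟩
  obtain ⟨e, hev, hez⟩ := hex
  obtain ⟨h1, h2, h3⟩ := hnext e hev
  obtain ⟨h4, h5, h6⟩ := hnext (R.next e) ((R.fst_next e).trans hev)
  have h7 : f (R.next (R.next e)).snd = z :=
    (key _ _ z _ _ hy hz hyz h1 h2 h4 h5 h6).resolve_left (hez ▸ h3.symm)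
  -- Color `z` recurs two steps later, at a different vertex.
  exact R.snd_next_next_ne hR hV e
    ((Set.ncard_le_one (Set.toFinite _)).1 hcard _ h7 _ hez)

theorem Coloring.ncard_verts_bicolored {C : Type*} (f : G.Coloring C) {i j : C} (h : i ≠ j) :
    (f.bicolored i j).verts.ncard = {v | f v = i}.ncard + {v | f v = j}.ncard := by
  rw [← Set.ncard_union_eq _ (Set.toFinite _) (Set.toFinite _)]
  · rfl
  · rw [Set.disjoint_left]
    rintro v rfl h'
    exact h h'

theorem Coloring.ncard_edgeSet_le (f : G.Coloring (Fin 4)) :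
    G.edgeSet.ncard ≤
      ∑ p : Fin 4 × Fin 4 with p.1 < p.2, (f.bicolored p.1 p.2).coe.edgeSet.ncard := by
  have hsub : G.edgeSet ⊆
      ⋃ p ∈ ({p : Fin 4 × Fin 4 | p.1 < p.2} : Finset _), (f.bicolored p.1 p.2).edgeSet := by
    intro e he
    induction e with
    | _ x y =>
      rw [mem_edgeSet] at he
      simp only [Set.mem_iUnion]
      rcases lt_or_gt_of_ne (f.valid he) with h | h
      · exact ⟨(f x, f y), by simpa using h, Or.inl rfl, Or.inr rfl, he⟩
      · exact ⟨(f y, f x), by simpa using h, Or.inr rfl, Or.inl rfl, he⟩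
  refine (Set.ncard_le_ncard hsub (Set.toFinite _)).trans ?_
  refine (Finset.set_ncard_biUnion_le _ _).trans (Finset.sum_le_sum fun p _ => ?_)
  rw [Subgraph.ncard_edgeSet_coe]

theorem Coloring.card_eq_sum (f : G.Coloring (Fin 4)) :
    Nat.card V = ∑ i, {v | f v = i}.ncard := by
  classical
  have := Fintype.ofFinite V
  rw [Nat.card_eq_fintype_card, ← Finset.card_univ,
    Finset.card_eq_sum_card_fiberwise (t := Finset.univ) (f := f) (fun _ _ => by simp)]
  refine Finset.sum_congr rfl fun i _ => ?_
  rw [← Set.ncard_coe_finset]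
  simp

/-- Each color lies in three of the six pairs, so the forest bounds add up to $3|V|-6$, which is the
number of edges. No bound has any slack, and a forest that attains it is connected. -/
theorem Coloring.IsTreeColoring.connected_bicolored_of_lt {f : G.Coloring (Fin 4)}
    (hf : f.IsTreeColoring) {R : G.RotationSystem} (hR : R.IsMaximalPlanar)
    (hV : 4 ≤ Nat.card V) {i j : Fin 4} (hij : i < j) : (f.bicolored i j).coe.Connected := by
  -- All colors occur; the forest bound would fail for an empty vertex set.
  have hne : ∀ k, ∃ v, f v = k := by
    intro k
    obtain ⟨v⟩ := hR.1.1.nonempty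
    by_cases h : f v = k
    · exact ⟨v, h⟩
    · obtain ⟨u, -, hu⟩ := hf.exists_adj_color hR hV v h
      exact ⟨u, hu⟩
  have hnon : ∀ k l, Nonempty (f.bicolored k l).verts := fun k l =>
    (hne k).elim fun v hv => ⟨⟨v, Or.inl hv⟩⟩
  have hle : ∀ k l, k < l → (f.bicolored k l).coe.edgeSet.ncard + 1 ≤
      {v | f v = k}.ncard + {v | f v = l}.ncard := by
    intro k l hkl
    have := (hf k l hkl.ne).ncard_edgeSet_lt
    rwa [Nat.card_coe_set_eq, f.ncard_verts_bicolored hkl.ne] at this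
  refine (hf i j hij.ne).connected_of_card_le ?_
  rw [Nat.card_coe_set_eq, f.ncard_verts_bicolored hij.ne]
  have h1 := f.ncard_edgeSet_le
  have h2 := f.card_eq_sum
  have h3 := hR.ncard_edgeSet
  have hs : ({p : Fin 4 × Fin 4 | p.1 < p.2} : Finset _) =
      {(0, 1), (0, 2), (0, 3), (1, 2), (1, 3), (2, 3)} := by decide
  rw [hs] at h1
  simp only [Finset.sum_insert, Finset.mem_insert, Finset.mem_singleton, Prod.mk.injEq,
    Finset.sum_singleton, Fin.isValue, Fin.reduceEq, and_false, or_self,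
    not_false_eq_true, and_true] at h1
  rw [Fin.sum_univ_four] at h2
  have h01 := hle 0 1 (by decide)
  have h02 := hle 0 2 (by decide)
  have h03 := hle 0 3 (by decide)
  have h12 := hle 1 2 (by decide)
  have h13 := hle 1 3 (by decide)
  have h23 := hle 2 3 (by decide)
  fin_cases i <;> fin_cases j <;>
    first
    | exact absurd hij (by decide)
    | simp only [Fin.isValue, Fin.reduceFinMk, Fin.zero_eta, Fin.mk_one] at *
      omega

theorem Coloring.IsTreeColoring.connected_bicolored {f : G.Coloring (Fin 4)}
    (hf : f.IsTreeColoring) {R : G.RotationSystem} (hR : R.IsMaximalPlanar)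
    (hV : 4 ≤ Nat.card V) {i j : Fin 4} (hij : i ≠ j) : (f.bicolored i j).coe.Connected := by
  rcases lt_or_gt_of_ne hij with h | h
  · exact hf.connected_bicolored_of_lt hR hV h
  · rw [f.bicolored_comm]
    exact hf.connected_bicolored_of_lt hR hV h

end Triangulation

/-! ### Unions of two bicolored subgraphs with a common color -/

/-- Two edge-disjoint connected subgraphs with two common vertices: each of these lies on a cycle
of the union. -/
theorem Subgraph.exists_isCycle_sup {V : Type*} {G : SimpleGraph V} {K L : G.Subgraph}
    (hK : K.coe.Connected) (hL : L.coe.Connected) (hKL : ∀ x y, K.Adj x y → ¬ L.Adj x y)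
    {u v : V} (huv : u ≠ v) (huK : u ∈ K.verts) (hvK : v ∈ K.verts) (huL : u ∈ L.verts)
    (hvL : v ∈ L.verts) (hu : u ∈ (K ⊔ L).verts) :
    ∃ w : (K ⊔ L).coe.Walk ⟨u, hu⟩ ⟨u, hu⟩, w.IsCycle := by
  classical
  obtain ⟨p, hp⟩ := hK.exists_isPath ⟨u, huK⟩ ⟨v, hvK⟩
  obtain ⟨r⟩ := hL.preconnected ⟨u, huL⟩ ⟨v, hvL⟩
  cases p with
  | nil => exact absurd rfl huv
  | @cons _ x _ h q =>
    rw [Walk.cons_isPath_iff] at hp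
    let i : K.coe →g (K ⊔ L).coe := Subgraph.inclusion le_sup_left
    let j : L.coe →g (K ⊔ L).coe := Subgraph.inclusion le_sup_right
    let r' : (K ⊔ L).coe.Walk ⟨u, hu⟩ (i ⟨v, hvK⟩) := r.map j
    have hux : (K ⊔ L).coe.Adj ⟨u, hu⟩ (i x) := i.map_adj h
    -- The first edge $ux$ of a path in `K` is bypassed by going to $v$ inside `L` and back to $x$
    -- along the rest of the path, which no longer meets $u$.
    refine exists_isCycle_of_reachable_deleteEdges hux
      (reachable_deleteEdges_iff_exists_walk.2 ⟨r'.append (q.map i).reverse, ?_⟩)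
    rw [Walk.edges_append, List.mem_append, Walk.edges_reverse, List.mem_reverse]
    rintro (hr | hq)
    · obtain ⟨e, he, hej⟩ := List.mem_map.1 ((Walk.edges_map j r) ▸ hr)
      have heL := r.edges_subset_edgeSet he
      induction e with
      | _ y z =>
        have hyz : L.Adj y.1 z.1 := heL
        have := congrArg (Sym2.map Subtype.val) hej
        rcases Sym2.eq_iff.1 this with ⟨h1, h2⟩ | ⟨h1, h2⟩
        · change y.1 = u at h1
          change z.1 = x.1 at h2
          rw [h1, h2] at hyz
          exact hKL _ _ h hyz
        · change y.1 = x.1 at h1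
          change z.1 = u at h2
          rw [h1, h2] at hyz
          exact hKL _ _ h hyz.symm
    · have := Walk.fst_mem_support_of_mem_edges _ hq
      rw [Walk.support_map, List.mem_map] at this
      obtain ⟨y, hy, hyu⟩ := this
      have : y = ⟨u, huK⟩ := Subtype.ext (congrArg (fun t => t.1) hyu)
      exact hp.2 (this ▸ hy)

namespace Coloring

variable {V C : Type*} {G : SimpleGraph V} (f : G.Coloring C) {a b c : C}

theorem mem_verts_bicolored_sup {v : V} :
    v ∈ (f.bicolored a b ⊔ f.bicolored a c).verts ↔ f v = a ∨ f v = b ∨ f v = c := by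
  rw [Subgraph.verts_sup]
  change (f v = a ∨ f v = b) ∨ (f v = a ∨ f v = c) ↔ _
  tauto

theorem bicolored_sup_adj {u v : V} :
    (f.bicolored a b ⊔ f.bicolored a c).Adj u v ↔ G.Adj u v ∧
      (f u = a ∧ (f v = b ∨ f v = c) ∨ f v = a ∧ (f u = b ∨ f u = c)) := by
  rw [Subgraph.sup_adj]
  change ((f u = a ∨ f u = b) ∧ (f v = a ∨ f v = b) ∧ G.Adj u v) ∨
    ((f u = a ∨ f u = c) ∧ (f v = a ∨ f v = c) ∧ G.Adj u v) ↔ _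
  constructor
  · rintro (⟨h1, h2, h⟩ | ⟨h1, h2, h⟩) <;>
    · have := f.valid h
      refine ⟨h, ?_⟩
      rcases h1 with h1 | h1 <;> rcases h2 with h2 | h2 <;> simp_all
  · rintro ⟨h, ⟨h1, h2 | h2⟩ | ⟨h1, h2 | h2⟩⟩ <;> simp [h, h1, h2]

/-- The coloring of `G[a, b] ∪ G[a, c]` that tells the common color from the others. -/
def bicoloredSupColoring [DecidableEq C] (hab : a ≠ b) (hac : a ≠ c) :
    (f.bicolored a b ⊔ f.bicolored a c).coe.Coloring Bool :=
  Coloring.mk (fun v => decide (f v = a)) (by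
    intro u v h
    rcases (f.bicolored_sup_adj.1 h).2 with ⟨h1, h2 | h2⟩ | ⟨h1, h2 | h2⟩ <;>
      simp [h1, h2, hab.symm, hac.symm])

theorem not_bicolored_adj_of_bicolored_adj (hac : a ≠ c) (hbc : b ≠ c) (u v : V)
    (h : (f.bicolored a b).Adj u v) : ¬ (f.bicolored a c).Adj u v := by
  rintro ⟨h1, h2, -⟩
  obtain ⟨h3, h4, h5⟩ := h
  have := f.valid h5
  change f u = a ∨ f u = b at h3
  change f v = a ∨ f v = b at h4
  change f u = a ∨ f u = c at h1
  change f v = a ∨ f v = c at h2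
  rcases h1 with h1 | h1
  · rcases h2 with h2 | h2
    · exact this (h1.trans h2.symm)
    · rcases h4 with h4 | h4
      · exact hac (h4.symm.trans h2)
      · exact hbc (h4.symm.trans h2)
  · rcases h3 with h3 | h3
    · exact hac (h3.symm.trans h1)
    · exact hbc (h3.symm.trans h1)

/-- If no vertex is joined to two vertices of the common color, the union is a forest of stars. -/
theorem isAcyclic_bicolored_sup
    (h : ∀ p q x, f p = a → f q = a → (f.bicolored a b ⊔ f.bicolored a c).Adj x p →
      (f.bicolored a b ⊔ f.bicolored a c).Adj x q → p = q) :
    (f.bicolored a b ⊔ f.bicolored a c).coe.IsAcyclic := by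
  set H := f.bicolored a b ⊔ f.bicolored a c with hH
  -- A walk from `x` to `p` must start with a step to a vertex of color `a`, and `p` is the only
  -- such neighbor. So every edge is a bridge.
  have key : ∀ x p : H.verts, H.coe.Adj x p → f p = a → H.coe.IsBridge s(x, p) := by
    intro x p hxp hp
    rw [isBridge_iff_forall_walk_mem_edges]
    intro w
    have hx : f x ≠ a := fun hx => f.valid (H.adj_sub hxp) (hx.trans hp.symm)
    cases w with
    | nil => exact absurd hp hx
    | @cons _ y _ hxy w =>
      have hy : f y = a := ((f.bicolored_sup_adj.1 hxy).2.resolve_left fun t => hx t.1).1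
      have : y = p := Subtype.ext (h _ _ x hy hp hxy hxp)
      subst this
      simp
  rw [isAcyclic_iff_forall_adj_isBridge]
  intro x y hxy
  rcases (f.bicolored_sup_adj.1 hxy).2 with ⟨hx, -⟩ | ⟨hy, -⟩
  · rw [Sym2.eq_swap]
    exact key y x hxy.symm hx
  · exact key x y hxy hy

theorem connected_bicolored_sup {v : V} (hv : f v = a) (hb : (f.bicolored a b).coe.Connected)
    (hc : (f.bicolored a c).coe.Connected) :
    (f.bicolored a b ⊔ f.bicolored a c).coe.Connected :=
  (Subgraph.connected_sup ⟨hb.preconnected⟩ ⟨hc.preconnected⟩ ⟨v, Or.inl hv, Or.inl hv⟩).coe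

/-- Without color `a` the bicolored graph has no edges. -/
theorem subsingleton_of_connected_bicolored (ha : ∀ v, f v ≠ a)
    (hb : (f.bicolored a b).coe.Connected) : {v | f v = b}.Subsingleton := by
  intro u hu v hv
  have := hb.mem_of_adj_closed (s := {⟨u, Or.inr hu⟩}) (u := ⟨u, Or.inr hu⟩) (by
    rintro _ rfl ⟨w, hw⟩ h
    have hne := f.valid ((f.bicolored a b).adj_sub h)
    have hw' : f w = b := hw.resolve_left (ha w)
    exact absurd (hu.trans hw'.symm) hne) rfl ⟨v, Or.inr hv⟩
  exact (congrArg Subtype.val this).symm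

/-- The union is a 4-cycle if there are two vertices of the common color and one of each of the
others, and these are adjacent to both of the former. -/
theorem nonempty_iso_cycleGraph_four (hab : a ≠ b) (hac : a ≠ c) (hbc : b ≠ c)
    {p q x y : V} (hpq : p ≠ q) (ha : ∀ v, f v = a ↔ v = p ∨ v = q) (hb : ∀ v, f v = b ↔ v = x)
    (hc : ∀ v, f v = c ↔ v = y) (hx : ∀ v, f v = a → G.Adj v x) (hy : ∀ v, f v = a → G.Adj v y) :
    Nonempty ((f.bicolored a b ⊔ f.bicolored a c).coe ≃g cycleGraph 4) := by
  set H := f.bicolored a b ⊔ f.bicolored a c with hH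
  have hfp : f p = a := (ha p).2 (Or.inl rfl)
  have hfq : f q = a := (ha q).2 (Or.inr rfl)
  have hfx : f x = b := (hb x).2 rfl
  have hfy : f y = c := (hc y).2 rfl
  have hadj' : ∀ u v, f u = a → f v = b ∨ f v = c → H.Adj u v := by
    intro u v hu hv
    refine f.bicolored_sup_adj.2 ⟨?_, Or.inl ⟨hu, hv⟩⟩
    rcases hv with hv | hv
    · rw [(hb v).1 hv]
      exact hx u hu
    · rw [(hc v).1 hv]
      exact hy u hu
  -- The union is complete bipartite, and the 4-cycle is $K_{2,2}$ with the parity classes as its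
  -- sides; hence color `a` goes to the even indices.
  have hadj : ∀ u v : H.verts, H.Adj u v ↔ ¬ (f u = a ↔ f v = a) := by
    intro u v
    have hu := f.mem_verts_bicolored_sup.1 u.2
    have hv := f.mem_verts_bicolored_sup.1 v.2
    constructor
    · intro h
      rcases (f.bicolored_sup_adj.1 h).2 with ⟨h1, h2 | h2⟩ | ⟨h1, h2 | h2⟩ <;>
        simp [h1, h2, hab.symm, hac.symm]
    · intro h
      by_cases hua : f u = a
      · exact hadj' u v hua (hv.resolve_left fun t => h (by simp [hua, t]))
      · by_cases hva : f v = a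
        · exact (hadj' v u hva (hu.resolve_left hua)).symm
        · exact absurd (by simp [hua, hva]) h
  let g : Fin 4 → H.verts := ![⟨p, f.mem_verts_bicolored_sup.2 (Or.inl hfp)⟩,
    ⟨x, f.mem_verts_bicolored_sup.2 (Or.inr (Or.inl hfx))⟩,
    ⟨q, f.mem_verts_bicolored_sup.2 (Or.inl hfq)⟩,
    ⟨y, f.mem_verts_bicolored_sup.2 (Or.inr (Or.inr hfy))⟩]
  have hg : ∀ i, f (g i) = a ↔ i.1 % 2 = 0 := by
    intro i
    fin_cases i <;> simp [g, hfp, hfq, hfx, hfy, hab.symm, hac.symm]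
  have hpx : p ≠ x := by rintro rfl; exact hab (hfp.symm.trans hfx)
  have hpy : p ≠ y := by rintro rfl; exact hac (hfp.symm.trans hfy)
  have hqx : q ≠ x := by rintro rfl; exact hab (hfq.symm.trans hfx)
  have hqy : q ≠ y := by rintro rfl; exact hac (hfq.symm.trans hfy)
  have hxy : x ≠ y := by rintro rfl; exact hbc (hfx.symm.trans hfy)
  have hinj : Function.Injective g := by
    intro i j h
    have := congrArg Subtype.val h
    fin_cases i <;> fin_cases j <;>
      simp_all [g, hpx.symm, hpy.symm, hqx.symm, hqy.symm, hxy.symm, hpq.symm]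
  have hsurj : Function.Surjective g := by
    rintro ⟨v, hv⟩
    rcases f.mem_verts_bicolored_sup.1 hv with h | h | h
    · rcases (ha v).1 h with rfl | rfl
      · exact ⟨0, rfl⟩
      · exact ⟨2, rfl⟩
    · obtain rfl := (hb v).1 h
      exact ⟨1, rfl⟩
    · obtain rfl := (hc v).1 h
      exact ⟨3, rfl⟩
  have hcyc : ∀ i j : Fin 4, (cycleGraph 4).Adj i j ↔ ¬ (i.1 % 2 = 0 ↔ j.1 % 2 = 0) := by
    decide
  refine ⟨RelIso.symm ⟨Equiv.ofBijective g ⟨hinj, hsurj⟩, fun {i j} => ?_⟩⟩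
  rw [hcyc, ← hg, ← hg]
  exact hadj _ _

end Coloring

end SimpleGraph

open SimpleGraph

/-! ### Proof of the four statements -/

theorem theorem5p5 {V : Type*} [Finite V] (G : SimpleGraph V)
    (R : G.RotationSystem) (hR : R.IsMaximalPlanar)
    (f : G.Coloring (Fin 4)) (a b c : Fin 4) (hab : a ≠ b) (hac : a ≠ c) (hbc : b ≠ c)
    (H : G.Subgraph) (hH : H = f.bicolored a b ⊔ f.bicolored a c) :
    -- (1)
    (∀ (v : H.verts) (w : H.coe.Walk v v), w.IsCycle → ¬ Odd w.length) ∧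
    -- (2)
    (4 ≤ Nat.card V →
      (f.bicolored a b).verts.ncard ≤ 3 → (f.bicolored a c).verts.ncard ≤ 3 →
        ({v | f v = a}.ncard = 2 → Nonempty (H.coe ≃g SimpleGraph.cycleGraph 4)) ∧
        ({v | f v = a}.ncard ≠ 2 →
          H.coe.IsAcyclic ∧
          (f.IsTreeColoring ∨
              ((f.bicolored a b).coe.Connected ∧ (f.bicolored a c).coe.Connected) →
            H.coe.IsTree))) ∧
    -- (3)
    (f.IsTreeColoring →
      4 ≤ (f.bicolored a b).verts.ncard ∨ 4 ≤ (f.bicolored a c).verts.ncard →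
        (R.restrict H).IsFence ∧
        ((R.restrict H).IsTFence 0 ∨ (R.restrict H).IsTFence 1 ∨
          ({v | f v = a}.ncard = 1 ∧ H.coe.IsTree))) ∧
    -- (4)
    (4 ≤ Nat.card V → f.IsTreeColoring →
      ∀ v : H.verts, H.coe.IsSuspending v → ∃ u : H.verts, H.coe.Adj v u ∧ f u = a) := by
  subst hH
  set H := f.bicolored a b ⊔ f.bicolored a c with hH
  have hstar : {v | f v = a}.ncard ≤ 1 → H.coe.IsAcyclic := fun h =>
    f.isAcyclic_bicolored_sup fun p q _ hp hq _ _ =>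
      (Set.ncard_le_one (Set.toFinite _)).1 h _ hp _ hq
  have hsusp : 4 ≤ Nat.card V → f.IsTreeColoring →
      ∀ v : H.verts, H.coe.IsSuspending v → ∃ u : H.verts, H.coe.Adj v u ∧ f u = a := by
    intro hV hf v hv
    by_cases hva : f v = a
    · obtain ⟨x, hx, hxb⟩ := hf.exists_adj_color hR hV v (hva.trans_ne hab)
      obtain ⟨y, hy, hyc⟩ := hf.exists_adj_color hR hV v (hva.trans_ne hac)
      have hHx : H.Adj v x := f.bicolored_sup_adj.2 ⟨hx, Or.inl ⟨hva, Or.inl hxb⟩⟩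
      have hHy : H.Adj v y := f.bicolored_sup_adj.2 ⟨hy, Or.inl ⟨hva, Or.inr hyc⟩⟩
      have := Set.encard_le_one_iff.1 hv ⟨x, H.edge_vert hHx.symm⟩ ⟨y, H.edge_vert hHy.symm⟩ hHx hHy
      have hxy : x = y := congrArg Subtype.val this
      exact absurd (hxb.symm.trans (hxy ▸ hyc)) hbc
    · obtain ⟨u, hu, hua⟩ := hf.exists_adj_color hR hV v hva
      have hHu : H.Adj v u := f.bicolored_sup_adj.2
        ⟨hu, Or.inr ⟨hua, (f.mem_verts_bicolored_sup.1 v.2).resolve_left hva⟩⟩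
      exact ⟨⟨u, H.edge_vert hHu.symm⟩, hHu, hua⟩
  have hexa : 4 ≤ Nat.card V → f.IsTreeColoring → ∃ v, f v = a := by
    intro hV hf
    obtain ⟨v⟩ := hR.1.1.nonempty
    by_cases h : f v = a
    · exact ⟨v, h⟩
    · exact (hf.exists_adj_color hR hV v h).imp fun _ h => h.2
  refine ⟨?_, ?_, ?_, hsusp⟩
  · intro v w _
    rw [Nat.not_odd_iff_even, (f.bicoloredSupColoring hab hac).even_length_iff_congr w]
  · intro hV hb hc
    rw [f.ncard_verts_bicolored hab] at hb
    rw [f.ncard_verts_bicolored hac] at hc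
    constructor
    · intro h2
      obtain ⟨p, q, hpq, hpq'⟩ := Set.ncard_eq_two.1 h2
      have ha : ∀ v, f v = a ↔ v = p ∨ v = q := fun v => Set.ext_iff.1 hpq' v
      have hb1 : {v | f v = b}.ncard ≤ 1 := by omega
      have hc1 : {v | f v = c}.ncard ≤ 1 := by omega
      have hnb : ∀ v, f v = a → ∃ u, G.Adj v u ∧ f u = b := fun v hv =>
        f.exists_adj_color_of_ncard_le_one hR hV v (hv.trans_ne hab) (hv.trans_ne hac) hbc hc1
      have hnc : ∀ v, f v = a → ∃ u, G.Adj v u ∧ f u = c := fun v hv =>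
        f.exists_adj_color_of_ncard_le_one hR hV v (hv.trans_ne hac) (hv.trans_ne hab) hbc.symm hb1
      rw [Set.ncard_le_one (Set.toFinite _)] at hb1 hc1
      obtain ⟨x, -, hx⟩ := hnb p ((ha p).2 (Or.inl rfl))
      obtain ⟨y, -, hy⟩ := hnc p ((ha p).2 (Or.inl rfl))
      refine f.nonempty_iso_cycleGraph_four hab hac hbc hpq ha (x := x) (y := y)
        (fun v => ⟨fun hv => hb1 _ hv _ hx, fun h => h ▸ hx⟩)
        (fun v => ⟨fun hv => hc1 _ hv _ hy, fun h => h ▸ hy⟩) (fun v hv => ?_) (fun v hv => ?_)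
      · obtain ⟨u, hu, hub⟩ := hnb v hv
        exact hb1 _ hub _ hx ▸ hu
      · obtain ⟨u, hu, huc⟩ := hnc v hv
        exact hc1 _ huc _ hy ▸ hu
    · intro h2
      have hac' : H.coe.IsAcyclic := by
        by_cases h1 : {v | f v = a}.ncard ≤ 1
        · exact hstar h1
        -- Now at least three vertices have color `a`, which leaves no room for `b` and `c`: the
        -- union has no edges.
        · have hb0 : {v | f v = b} = ∅ := (Set.ncard_eq_zero (Set.toFinite _)).1 (by omega)
          have hc0 : {v | f v = c} = ∅ := (Set.ncard_eq_zero (Set.toFinite _)).1 (by omega)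
          refine f.isAcyclic_bicolored_sup fun p q x hp hq hxp _ => ?_
          have hx : f x = b ∨ f x = c := by
            rcases (f.bicolored_sup_adj.1 hxp).2 with ⟨-, h⟩ | ⟨-, h⟩
            · rcases h with h | h
              · exact absurd (hp.symm.trans h) hab
              · exact absurd (hp.symm.trans h) hac
            · exact h
          rcases hx with hx | hx
          · exact absurd hx (Set.eq_empty_iff_forall_notMem.1 hb0 x)
          · exact absurd hx (Set.eq_empty_iff_forall_notMem.1 hc0 x)
      refine ⟨hac', fun h => ⟨?_, hac'⟩⟩
      rcases h with hf | ⟨hb', hc'⟩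
      · obtain ⟨v, hv⟩ := hexa hV hf
        exact f.connected_bicolored_sup hv (hf.connected_bicolored hR hV hab)
          (hf.connected_bicolored hR hV hac)
      · by_cases hex : ∃ v, f v = a
        · obtain ⟨v, hv⟩ := hex
          exact f.connected_bicolored_sup hv hb' hc'
        · push Not at hex
          have hbs := (Set.ncard_le_one_iff_subsingleton).2
            (f.subsingleton_of_connected_bicolored hex hb')
          have hcs := (Set.ncard_le_one_iff_subsingleton).2
            (f.subsingleton_of_connected_bicolored hex hc')
          have ha0 : {v | f v = a}.ncard = 0 := by
            rw [Set.ncard_eq_zero (Set.toFinite _), Set.eq_empty_iff_forall_notMem]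
            exact hex
          -- Colors `b` and `c` cover at most two of the at least four vertices. A vertex of the
          -- fourth color must see color `a`, since `b` occurs at most once.
          exfalso
          obtain ⟨v, hvb, hvc⟩ : ∃ v, f v ≠ b ∧ f v ≠ c := by
            by_contra! hall
            have : (Set.univ : Set V) ⊆ {v | f v = b} ∪ {v | f v = c} := fun v _ => by
              by_cases h : f v = b
              · exact Or.inl h
              · exact Or.inr (hall v h)
            have h1 := Set.ncard_le_ncard this (Set.toFinite _)
            have h3 := Set.ncard_union_le {v | f v = b} {v | f v = c}
            rw [Set.ncard_univ] at h1
            omega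
          obtain ⟨u, -, hu⟩ := f.exists_adj_color_of_ncard_le_one hR hV v (y := a) (hex v) hvb hab
            hbs
          exact hex u hu
  · intro hf h4
    have hV : 4 ≤ Nat.card V := by
      rcases h4 with h4 | h4 <;> exact h4.trans (Set.ncard_le_card _)
    obtain ⟨v, hv⟩ := hexa hV hf
    have hcb := hf.connected_bicolored hR hV hab
    have hcc := hf.connected_bicolored hR hV hac
    have hcon := f.connected_bicolored_sup hv hcb hcc
    have hF : (R.restrict H).IsFence := by
      refine (R.restrict H).isFence_of_coloring_bool (f.bicoloredSupColoring hab hac) hcon ?_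
      rw [Nat.card_coe_set_eq]
      rcases h4 with h4 | h4
      · exact (show 3 ≤ 4 by norm_num).trans
          (h4.trans (Set.ncard_le_ncard Set.subset_union_left (Set.toFinite _)))
      · exact (show 3 ≤ 4 by norm_num).trans
          (h4.trans (Set.ncard_le_ncard Set.subset_union_right (Set.toFinite _)))
    refine ⟨hF, ?_⟩
    have hpos : 0 < {v | f v = a}.ncard := (Set.ncard_pos (Set.toFinite _)).2 ⟨v, hv⟩
    by_cases h1 : {v | f v = a}.ncard = 1
    · exact Or.inr (Or.inr ⟨h1, hcon, hstar h1.le⟩)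
    have hdepth : H.coe.suspensionDepth ≤ 1 := by
      refine iSup₂_le fun x hx => ?_
      obtain ⟨u, hxu, hu⟩ := hsusp hV hf x hx
      -- A second vertex of color `a` puts the neighbor `u` of `x` on a cycle.
      obtain ⟨u', hu', hne⟩ := Set.exists_ne_of_one_lt_ncard
        (show 1 < {v | f v = a}.ncard by omega) u.1
      have hcyc := Subgraph.exists_isCycle_sup hcb hcc
        (f.not_bicolored_adj_of_bicolored_adj hac hbc) hne.symm (Or.inl hu) (Or.inl hu')
        (Or.inl hu) (Or.inl hu') u.2
      exact (iInf₂_le u hcyc).trans (edist_le_one_iff_adj_or_eq.2 (Or.inl hxu))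
    rcases hdepth.eq_or_lt with h | h
    · exact Or.inr (Or.inl ⟨hF, h⟩)
    · exact Or.inl ⟨hF, Order.lt_one_iff.1 h⟩
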